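/- Let $\mathbb{D}=\{z\in\mathbb{C}:|z|<1\}$ and let $\mathcal{H}$ be the class of complex-valued harmonic functions $f$ in $\mathbb{D}$ with $f(0)=0$, $f_z(0)=1$, $f_{\bar z}(0)=0$; each such $f$ is written uniquely as $f=h+\overline{g}$ with $h,g$ analytic in $\mathbb{D}$ and $h(0)=g(0)=0$. Let $\mathcal{S}_H^0$ be the class of those $f\in\mathcal{H}$ that are univalent (injective) and sense-preserving in $\mathbb{D}$, i.e. whose Jacobian $J_f=|h'|^2-|g'|^2$ is positive in $\mathbb{D}$; let $\mathcal{K}_H^0$ be the class of those $f\in\mathcal{S}_H^0$ that map $\mathbb{D}$ onto a convex domain; and let $\mathcal{W}_H^-(z)$ be the class of those $f=h+\overline{g}\in\mathcal{H}$ with $h(z)-g(z)=z$ for all $z\in\mathbb{D}$. For $f=h+\overline{g}\in\mathcal{H}$ let $$\Lambda_H^+[f](z)=\int_0^z\frac{h(t)}{t}\,dt+\overline{\int_0^z\frac{g(t)}{t}\,dt}\qquad(z\in\mathbb{D}).$$ If $f\in\mathcal{W}_H^-(z)\cap\mathcal{K}_H^0$, then $\Lambda_H^+[f]\in\mathcal{S}_H^0$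 and $\Lambda_H^+[f]$ is convex in the direction of the real axis, that is, $\Lambda_H^+[f](\mathbb{D})$ is a domain whose intersection with each horizontal line is connected (possibly empty). -/

import Mathlib

open Complex Set Metric InnerProductSpace
open scoped ComplexConjugate

namespace PlanarHarmonic

/-- The open unit disk `𝔻 = {z : |z| < 1}`. -/
def unitDisk : Set ℂ := ball 0 1

/-- The Wirtinger derivative `f_z = (f_x - i f_y) / 2`. -/
noncomputable def dz (f : ℂ → ℂ) (z : ℂ) : ℂ :=
  (fderiv ℝ f z 1 - I * fderiv ℝ f z I) / 2

/-- The Wirtinger derivative `f_{z̄} = (f_x + i f_y) / 2`. -/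
noncomputable def dzbar (f : ℂ → ℂ) (z : ℂ) : ℂ :=
  (fderiv ℝ f z 1 + I * fderiv ℝ f z I) / 2

/-- The Jacobian `J_f = |f_z|² - |f_{z̄}|²`, which is `|h'|² - |g'|²` for `f = h + conj g`. -/
noncomputable def jacobian (f : ℂ → ℂ) (z : ℂ) : ℝ :=
  ‖dz f z‖ ^ 2 - ‖dzbar f z‖ ^ 2

/-- The class `𝓗` of complex-valued harmonic functions in the unit disk, normalized by
`f(0) = 0 = f_z(0) - 1 = f_{z̄}(0)`. (Values outside the disk play no role.) -/
def classH : Set (ℂ → ℂ) :=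
  {f | HarmonicOnNhd f unitDisk ∧ f 0 = 0 ∧ dz f 0 = 1 ∧ dzbar f 0 = 0}

/-- `f = h + conj g` in the unit disk, with `h` and `g` analytic there and vanishing at `0`. -/
structure IsDecomposition (f h g : ℂ → ℂ) : Prop where
  analytic_h : AnalyticOnNhd ℂ h unitDisk
  analytic_g : AnalyticOnNhd ℂ g unitDisk
  h_zero : h 0 = 0
  g_zero : g 0 = 0
  eq_add : ∀ z ∈ unitDisk, f z = h z + conj (g z)

/-- Every function of the class `𝓗` has such a decomposition. -/
theorem exists_isDecomposition {f : ℂ → ℂ} (hf : f ∈ classH) :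
    ∃ h g : ℂ → ℂ, IsDecomposition f h g := by
  obtain ⟨hharm, h0, -, -⟩ := hf
  obtain ⟨F, hF, hFe⟩ := HarmonicOnNhd.exists_analyticOnNhd_ball_re_eq
    (hharm.comp_CLM Complex.reCLM)
  obtain ⟨G, hG, hGe⟩ := HarmonicOnNhd.exists_analyticOnNhd_ball_re_eq
    (hharm.comp_CLM Complex.imCLM)
  have m0 : (0 : ℂ) ∈ ball (0 : ℂ) 1 := by simp
  have hF0 : (F 0).re = 0 := by simpa [h0] using hFe m0
  have hG0 : (G 0).re = 0 := by simpa [h0] using hGe m0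
  refine ⟨fun z => ((F z - F 0) + I * (G z - G 0)) / 2,
    fun z => ((F z - F 0) - I * (G z - G 0)) / 2, ?_, ?_, by simp, by simp, ?_⟩
  · intro z hz
    have := hF z hz
    have := hG z hz
    fun_prop
  · intro z hz
    have := hF z hz
    have := hG z hz
    fun_prop
  · intro z hz
    have e1 : (F z).re = (f z).re := by simpa using hFe hz
    have e2 : (G z).re = (f z).im := by simpa using hGe hz
    apply Complex.ext
    · rw [add_re, conj_re]
      simp [← e1, hF0]
      ring
    · rw [add_im, conj_im]
      simp [← e2, hG0]
      ring

/-- The decomposition is unique on the disk. -/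
theorem IsDecomposition.eqOn {f h g h' g' : ℂ → ℂ} (H : IsDecomposition f h g)
    (H' : IsDecomposition f h' g') : EqOn h h' unitDisk ∧ EqOn g g' unitDisk := by
  have hopen : IsOpen unitDisk := isOpen_ball
  have m0 : (0 : ℂ) ∈ unitDisk := by simp [unitDisk]
  have key : ∀ z ∈ unitDisk, h z - h' z = conj (g' z - g z) := by
    intro z hz
    have := (H.eq_add z hz).symm.trans (H'.eq_add z hz)
    rw [map_sub]
    linear_combination this
  have dd : ∀ z ∈ unitDisk, deriv (fun w => h w - h' w) z = 0 := by
    intro z hz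
    have d1 : HasDerivAt (fun w => h w - h' w) (deriv (fun w => h w - h' w) z) z :=
      ((H.analytic_h z hz).differentiableAt.sub
        (H'.analytic_h z hz).differentiableAt).hasDerivAt
    have d2 : HasDerivAt (fun w => g' w - g w) (deriv (fun w => g' w - g w) z) z :=
      ((H'.analytic_g z hz).differentiableAt.sub
        (H.analytic_g z hz).differentiableAt).hasDerivAt
    have f1 := d1.hasFDerivAt.restrictScalars ℝ
    have f2 := (Complex.conjCLE.toContinuousLinearMap.hasFDerivAt).comp z
      (d2.hasFDerivAt.restrictScalars ℝ)
    have f3 := f2.congr_of_eventuallyEq (f₁ := fun w => h w - h' w) (by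
      filter_upwards [hopen.mem_nhds hz] with w hw
      simpa using key w hw)
    have e := f1.unique f3
    have e1 := congrArg (fun L => L 1) e
    have e2 := congrArg (fun L => L I) e
    simp at e1 e2
    rw [← e1] at e2
    have : I * (2 * deriv (fun w => h w - h' w) z) = 0 := by linear_combination e2
    simpa using this
  have hh : EqOn h h' unitDisk := by
    intro z hz
    have := hopen.is_const_of_deriv_eq_zero (convex_ball (0 : ℂ) 1).isPreconnected
      (f := fun w => h w - h' w)
      (fun w hw => ((H.analytic_h w hw).differentiableAt.sub
        (H'.analytic_h w hw).differentiableAt).differentiableWithinAt) dd hz m0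
    simp only [H.h_zero, H'.h_zero, sub_zero] at this
    exact sub_eq_zero.1 this
  refine ⟨hh, fun z hz => ?_⟩
  have := key z hz
  rw [hh hz, sub_self, eq_comm, map_eq_zero] at this
  exact (sub_eq_zero.1 this).symm

open Classical in
/-- The analytic part `h` of `f = h + conj g ∈ 𝓗` (`0` if there is no decomposition). -/
noncomputable def analyticPart (f : ℂ → ℂ) : ℂ → ℂ :=
  if H : ∃ h g : ℂ → ℂ, IsDecomposition f h g then H.choose else 0

open Classical in
/-- The co-analytic part `g` of `f = h + conj g ∈ 𝓗` (`0` if there is no decomposition). -/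
noncomputable def coanalyticPart (f : ℂ → ℂ) : ℂ → ℂ :=
  if H : ∃ h g : ℂ → ℂ, IsDecomposition f h g then H.choose_spec.choose else 0

theorem isDecomposition_parts {f : ℂ → ℂ} (hf : f ∈ classH) :
    IsDecomposition f (analyticPart f) (coanalyticPart f) := by
  have H := exists_isDecomposition hf
  simp only [analyticPart, coanalyticPart, dif_pos H]
  exact H.choose_spec.choose_spec

/-- `f` is sense-preserving in the disk: its Jacobian is positive there. -/
def SensePreserving (f : ℂ → ℂ) : Prop := ∀ z ∈ unitDisk, 0 < jacobian f z

/-- The class `𝓢_H⁰` of univalent sense-preserving functions in `𝓗`. -/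
def classSH0 : Set (ℂ → ℂ) := {f | f ∈ classH ∧ InjOn f unitDisk ∧ SensePreserving f}

/-- A domain in the plane: an open connected (nonempty) set. -/
def IsPlaneDomain (Ω : Set ℂ) : Prop := IsOpen Ω ∧ IsConnected Ω

/-- The class `𝓚_H⁰` of functions in `𝓢_H⁰` mapping the disk onto a convex domain. -/
def classKH0 : Set (ℂ → ℂ) :=
  {f | f ∈ classSH0 ∧ IsPlaneDomain (f '' unitDisk) ∧ Convex ℝ (f '' unitDisk)}

/-- A domain is convex in the direction of the real axis if its intersection with every
horizontal line is connected (possibly empty). -/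
def ConvexInRealDirection (Ω : Set ℂ) : Prop :=
  IsPlaneDomain Ω ∧ ∀ c : ℝ, IsPreconnected (Ω ∩ {w : ℂ | w.im = c})

/-- The class `𝓦_H⁻(φ) = {f = h + conj g ∈ 𝓗 : h - g = φ}`. -/
def classWHMinus (φ : ℂ → ℂ) : Set (ℂ → ℂ) :=
  {f | f ∈ classH ∧ ∀ z ∈ unitDisk, analyticPart f z - coanalyticPart f z = φ z}

/-- `∫₀ᶻ k(t)/t dt`, the integral being taken along the segment `t = s z`, `0 ≤ s ≤ 1`
(for `k` analytic in the disk with `k(0) = 0` the integrand extends analytically to `t = 0`). -/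
noncomputable def alexander (k : ℂ → ℂ) (z : ℂ) : ℂ :=
  ∫ s in (0 : ℝ)..1, k ((s : ℂ) * z) / ((s : ℂ) * z) * z

/-- The positive harmonic Alexander operator
`Λ_H⁺[f](z) = ∫₀ᶻ h(t)/t dt + conj (∫₀ᶻ g(t)/t dt)` for `f = h + conj g ∈ 𝓗`. -/
noncomputable def harmonicAlexander (f : ℂ → ℂ) (z : ℂ) : ℂ :=
  alexander (analyticPart f) z + conj (alexander (coanalyticPart f) z)

end PlanarHarmonic

/-!
Write `f = h + conj g` with `h - g = z`. The positive Alexander operator turns this into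
`F = H + conj G` with `H' = h / z`, `G' = g / z`, so again `H - G = z` and `F = z + 2 Re G`: the map
`F` slides each horizontal line along itself. For a pair whose derivatives differ by `1`, the
Jacobian `|H'|² - |G'|²` equals `1 + 2 Re G'`, which is also the derivative of `F` along
horizontal lines.

Everything therefore comes down to the inequality `Re G' > -1/2`. Since `f` is sense-preserving,
`Re g' > -1/2`, and `g(z) / z` is an average of `g'` over the radius `[0, z]`; the mean value
theorem gives `Re (g(z) / z) > -1/2` (`neg_half_lt_re_dslope`). Hence `F` is sense-preserving and
strictly increasing on horizontal chords, so injective. Its image is open by the inverse function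
theorem, and each horizontal slice of it is the continuous image of a chord of the disk.
-/

namespace PlanarHarmonic

lemma isOpen_unitDisk : IsOpen unitDisk := isOpen_ball

lemma zero_mem_unitDisk : (0 : ℂ) ∈ unitDisk := by simp [unitDisk]

lemma convex_unitDisk : Convex ℝ unitDisk := convex_ball 0 1

lemma ofReal_mul_mem_unitDisk {z : ℂ} (hz : z ∈ unitDisk) {s : ℝ} (hs : s ∈ Icc (0 : ℝ) 1) :
    (s : ℂ) * z ∈ unitDisk := by
  simpa using convex_unitDisk.smul_mem_of_zero_mem zero_mem_unitDisk hz hs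

/-! ### Derivatives of `h + conj g` -/

/-- The real differential `v ↦ a v + conj (b v)` of a planar map with `f_z = a` and
`f_{z̄} = conj b`. -/
noncomputable def wirtingerMap (a b : ℂ) : ℂ →L[ℝ] ℂ :=
  (ContinuousLinearMap.toSpanSingleton ℂ a).restrictScalars ℝ +
    Complex.conjCLE.toContinuousLinearMap.comp
      ((ContinuousLinearMap.toSpanSingleton ℂ b).restrictScalars ℝ)

@[simp] lemma wirtingerMap_apply (a b v : ℂ) :
    wirtingerMap a b v = a * v + conj (b * v) := by
  simp [wirtingerMap, mul_comm]

/-- A linear map with positive Jacobian is onto: it is injective because `‖a v‖ > ‖b v‖` for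
`v ≠ 0`. -/
lemma range_wirtingerMap {a b : ℂ} (hab : ‖b‖ < ‖a‖) : (wirtingerMap a b).range = ⊤ := by
  refine LinearMap.range_eq_top.2 (LinearMap.injective_iff_surjective.1 ?_)
  refine (injective_iff_map_eq_zero _).2 fun v hv => ?_
  have hv' : a * v + conj (b * v) = 0 := by simpa using hv
  have hn : ‖a‖ * ‖v‖ = ‖b‖ * ‖v‖ := by
    rw [← norm_mul, eq_neg_of_add_eq_zero_left hv', norm_neg, RCLike.norm_conj, norm_mul]
  by_contra h0
  exact hab.ne' (mul_right_cancel₀ (norm_ne_zero_iff.2 h0) hn)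

namespace IsDecomposition

variable {f h g : ℂ → ℂ} (D : IsDecomposition f h g)
include D

lemma hasStrictFDerivAt {z : ℂ} (hz : z ∈ unitDisk) :
    HasStrictFDerivAt f (wirtingerMap (deriv h z) (deriv g z)) z := by
  have h1 := (D.analytic_h z hz).hasStrictDerivAt.hasStrictFDerivAt.restrictScalars ℝ
  have h2 := Complex.conjCLE.toContinuousLinearMap.hasStrictFDerivAt.comp z
    ((D.analytic_g z hz).hasStrictDerivAt.hasStrictFDerivAt.restrictScalars ℝ)
  refine (h1.add h2).congr_of_eventuallyEq ?_
  filter_upwards [isOpen_unitDisk.mem_nhds hz] with w hw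
  simpa using (D.eq_add w hw).symm

lemma dz_eq {z : ℂ} (hz : z ∈ unitDisk) : dz f z = deriv h z := by
  rw [dz, (D.hasStrictFDerivAt hz).hasFDerivAt.fderiv]
  simp only [wirtingerMap_apply, map_mul, map_one, conj_I]
  linear_combination (-deriv h z / 2 + conj (deriv g z) / 2) * I_mul_I

lemma dzbar_eq {z : ℂ} (hz : z ∈ unitDisk) : dzbar f z = conj (deriv g z) := by
  rw [dzbar, (D.hasStrictFDerivAt hz).hasFDerivAt.fderiv]
  simp only [wirtingerMap_apply, map_mul, map_one, conj_I]
  linear_combination (deriv h z / 2 - conj (deriv g z) / 2) * I_mul_I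

lemma jacobian_eq {z : ℂ} (hz : z ∈ unitDisk) :
    jacobian f z = ‖deriv h z‖ ^ 2 - ‖deriv g z‖ ^ 2 := by
  rw [jacobian, D.dz_eq hz, D.dzbar_eq hz, RCLike.norm_conj]

lemma harmonicOnNhd : HarmonicOnNhd f unitDisk := by
  intro z hz
  have h1 : HarmonicAt h z := (D.analytic_h z hz).harmonicAt
  have h2 : HarmonicAt (fun w => conj (g w)) z :=
    (D.analytic_g z hz).harmonicAt.comp_CLM Complex.conjCLE.toContinuousLinearMap
  refine (harmonicAt_congr_nhds ?_).2 (h1.add h2)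
  filter_upwards [isOpen_unitDisk.mem_nhds hz] with w hw
  exact D.eq_add w hw

lemma continuousOn : ContinuousOn f unitDisk := fun _ hz =>
  (D.hasStrictFDerivAt hz).continuousAt.continuousWithinAt

lemma isOpen_image (hJ : SensePreserving f) : IsOpen (f '' unitDisk) := by
  refine isOpen_iff_mem_nhds.2 ?_
  rintro _ ⟨z, hz, rfl⟩
  have hlt : ‖deriv g z‖ < ‖deriv h z‖ := by
    have := hJ z hz
    rw [D.jacobian_eq hz, sub_pos] at this
    exact lt_of_pow_lt_pow_left₀ 2 (norm_nonneg _) this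
  rw [← (D.hasStrictFDerivAt hz).map_nhds_eq_of_surj (range_wirtingerMap hlt)]
  exact Filter.image_mem_map (isOpen_unitDisk.mem_nhds hz)

lemma isPlaneDomain_image (hJ : SensePreserving f) : IsPlaneDomain (f '' unitDisk) :=
  ⟨D.isOpen_image hJ, (convex_unitDisk.isConnected ⟨0, zero_mem_unitDisk⟩).image f D.continuousOn⟩

/-! ### Shears of the identity: `h - g = z` -/

section Shear

variable (hsub : ∀ z ∈ unitDisk, h z - g z = z)
include hsub

lemma deriv_eq_one_add {z : ℂ} (hz : z ∈ unitDisk) : deriv h z = 1 + deriv g z := by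
  have h1 : HasDerivAt (fun w => w + g w) (1 + deriv g z) z :=
    (hasDerivAt_id z).add (D.analytic_g z hz).differentiableAt.hasDerivAt
  refine (h1.congr_of_eventuallyEq ?_).deriv
  filter_upwards [isOpen_unitDisk.mem_nhds hz] with w hw
  linear_combination hsub w hw

lemma jacobian_eq_one_add {z : ℂ} (hz : z ∈ unitDisk) :
    jacobian f z = 1 + 2 * (deriv g z).re := by
  rw [D.jacobian_eq hz, D.deriv_eq_one_add hsub hz, ← normSq_eq_norm_sq, ← normSq_eq_norm_sq,
    normSq_apply, normSq_apply]
  simp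
  ring

lemma im_eq {z : ℂ} (hz : z ∈ unitDisk) : (f z).im = z.im := by
  have := congrArg Complex.im (hsub z hz)
  rw [D.eq_add z hz, ← this]
  simp [sub_eq_add_neg]

lemma mem_classH (hg0 : deriv g 0 = 0) : f ∈ classH := by
  refine ⟨D.harmonicOnNhd, ?_, ?_, ?_⟩
  · simp [D.eq_add 0 zero_mem_unitDisk, D.h_zero, D.g_zero]
  · simp [D.dz_eq zero_mem_unitDisk, D.deriv_eq_one_add hsub zero_mem_unitDisk, hg0]
  · simp [D.dzbar_eq zero_mem_unitDisk, hg0]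

/-- On a horizontal chord the derivative of `Re f` is the Jacobian `1 + 2 Re g'`. -/
lemma strictMonoOn_re (hJ : SensePreserving f) (c : ℝ) :
    StrictMonoOn (fun x : ℝ => (f (x + c * I)).re) {x : ℝ | (x + c * I : ℂ) ∈ unitDisk} := by
  have hd : ∀ x : ℝ, (x + c * I : ℂ) ∈ unitDisk →
      HasDerivAt (fun x : ℝ => (f (x + c * I)).re) (jacobian f (x + c * I)) x := by
    intro x hx
    have h1 : HasDerivAt (fun x : ℝ => (x + c * I : ℂ)) 1 x :=
      (hasDerivAt_id x).ofReal_comp.add_const _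
    have h2 := Complex.reCLM.hasFDerivAt.comp_hasDerivAt x
      ((D.hasStrictFDerivAt hx).hasFDerivAt.comp_hasDerivAt x h1)
    have e : jacobian f (x + c * I) =
        reCLM (wirtingerMap (deriv h (x + c * I)) (deriv g (x + c * I)) 1) := by
      rw [D.jacobian_eq_one_add hsub hx]
      simp [D.deriv_eq_one_add hsub hx]
      ring
    rw [e]
    exact h2
  refine strictMonoOn_of_deriv_pos ?_ (fun x hx => (hd x hx).continuousAt.continuousWithinAt) ?_
  · intro x hx y hy a b ha hb hab
    have := convex_unitDisk hx hy ha hb hab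
    have hab' : (a : ℂ) + b = 1 := by exact_mod_cast hab
    have e : ((a • x + b • y : ℝ) + c * I : ℂ) = a • (x + c * I : ℂ) + b • (y + c * I : ℂ) := by
      simp only [real_smul, smul_eq_mul, ofReal_add, ofReal_mul]
      linear_combination (-c * I) * hab'
    rw [mem_ofPred_eq, e]
    exact this
  · intro x hx
    have hx' := interior_subset hx
    rw [(hd x hx').deriv]
    exact hJ _ hx'

lemma injOn (hJ : SensePreserving f) : InjOn f unitDisk := by
  intro z hz w hw e
  have him : w.im = z.im := by rw [← D.im_eq hsub hz, ← D.im_eq hsub hw, e]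
  have ez : (z.re + z.im * I : ℂ) = z := re_add_im z
  have ew : (w.re + z.im * I : ℂ) = w := by rw [← him]; exact re_add_im w
  refine Complex.ext ((D.strictMonoOn_re hsub hJ z.im).injOn ?_ ?_ ?_) him.symm
  · simpa only [mem_ofPred_eq, ez]
  · simpa only [mem_ofPred_eq, ew]
  · simp only [ez, ew, e]

lemma convexInRealDirection_image (hJ : SensePreserving f) :
    ConvexInRealDirection (f '' unitDisk) := by
  refine ⟨D.isPlaneDomain_image hJ, fun c => ?_⟩
  have hconv : Convex ℝ (unitDisk ∩ {w : ℂ | w.im = c}) :=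
    convex_unitDisk.inter (convex_hyperplane Complex.imLm.isLinear c)
  have e : f '' unitDisk ∩ {w : ℂ | w.im = c} = f '' (unitDisk ∩ {w : ℂ | w.im = c}) := by
    ext w
    constructor
    · rintro ⟨⟨z, hz, rfl⟩, hw⟩
      exact ⟨z, ⟨hz, (D.im_eq hsub hz).symm.trans hw⟩, rfl⟩
    · rintro ⟨z, ⟨hz, hc⟩, rfl⟩
      exact ⟨⟨z, hz, rfl⟩, (D.im_eq hsub hz).trans hc⟩
  rw [e]
  exact hconv.isPreconnected.image f (D.continuousOn.mono inter_subset_left)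

end Shear

end IsDecomposition

/-! ### The Alexander operator -/

lemma analyticOnNhd_dslope {k : ℂ → ℂ} (hk : AnalyticOnNhd ℂ k unitDisk) :
    AnalyticOnNhd ℂ (dslope k 0) unitDisk :=
  ((differentiableOn_dslope (isOpen_unitDisk.mem_nhds zero_mem_unitDisk)).2
    hk.differentiableOn).analyticOnNhd isOpen_unitDisk

/-- `dslope k 0` is the analytic extension of `t ↦ k t / t` to the origin, and the segment integral
is its primitive. -/
lemma hasDerivAt_alexander {k : ℂ → ℂ} (hk : AnalyticOnNhd ℂ k unitDisk) (k0 : k 0 = 0)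
    {z : ℂ} (hz : z ∈ unitDisk) : HasDerivAt (alexander k) (dslope k 0 z) z := by
  have hq := analyticOnNhd_dslope hk
  obtain ⟨P, hP⟩ := hq.differentiableOn.isExactOn_ball
  have key : ∀ w ∈ unitDisk, alexander k w = P w - P 0 := by
    intro w hw
    have hray : ∀ s ∈ uIcc (0 : ℝ) 1, (s : ℂ) * w ∈ unitDisk := fun s hs =>
      ofReal_mul_mem_unitDisk hw (by rwa [uIcc_of_le zero_le_one] at hs)
    have hlin : ∀ s : ℝ, HasDerivAt (fun s : ℝ => (s : ℂ) * w) w s := fun s => by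
      simpa using (hasDerivAt_id s).ofReal_comp.mul_const w
    have hftc : ∫ s in (0 : ℝ)..1, dslope k 0 (s * w) * w = P w - P 0 := by
      have := intervalIntegral.integral_eq_sub_of_hasDerivAt
        (f := fun s : ℝ => P (s * w)) (f' := fun s : ℝ => dslope k 0 (s * w) * w) (a := 0) (b := 1)
        (fun s hs => (hP _ (hray s hs)).comp s (hlin s))
        (ContinuousOn.intervalIntegrable
          ((hq.continuousOn.comp (by fun_prop) hray).mul continuousOn_const))
      simpa using this
    rw [← hftc, alexander]
    rcases eq_or_ne w 0 with rfl | hw0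
    · simp
    refine intervalIntegral.integral_congr_ae (Filter.Eventually.of_forall fun s hs => ?_)
    have hs0 : s ≠ 0 := by
      rw [uIoc_of_le zero_le_one] at hs
      exact hs.1.ne'
    rw [dslope_of_ne _ (mul_ne_zero (ofReal_ne_zero.2 hs0) hw0), slope_def_field, k0, sub_zero,
      sub_zero]
  refine ((hP z hz).sub_const (P 0)).congr_of_eventuallyEq ?_
  filter_upwards [isOpen_unitDisk.mem_nhds hz] with w hw
  exact key w hw

lemma analyticOnNhd_alexander {k : ℂ → ℂ} (hk : AnalyticOnNhd ℂ k unitDisk) (k0 : k 0 = 0) :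
    AnalyticOnNhd ℂ (alexander k) unitDisk :=
  DifferentiableOn.analyticOnNhd
    (fun _ hz => (hasDerivAt_alexander hk k0 hz).differentiableAt.differentiableWithinAt)
    isOpen_unitDisk

@[simp] lemma alexander_zero (k : ℂ → ℂ) : alexander k 0 = 0 := by simp [alexander]

/-- `alexander h - alexander g` is the identity because its derivative is the difference quotient
of `h - g = z` at the origin. -/
lemma alexander_sub_alexander {h g : ℂ → ℂ} (hh : AnalyticOnNhd ℂ h unitDisk)
    (hg : AnalyticOnNhd ℂ g unitDisk) (h0 : h 0 = 0) (g0 : g 0 = 0)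
    (hsub : ∀ z ∈ unitDisk, h z - g z = z) {z : ℂ} (hz : z ∈ unitDisk) :
    alexander h z - alexander g z = z := by
  have hd : ∀ w ∈ unitDisk, dslope h 0 w - dslope g 0 w = 1 := by
    intro w hw
    rcases eq_or_ne w 0 with rfl | hw0
    · rw [dslope_same, dslope_same, ← deriv_fun_sub (hh 0 hw).differentiableAt
        (hg 0 hw).differentiableAt]
      refine ((hasDerivAt_id (0 : ℂ)).congr_of_eventuallyEq ?_).deriv
      filter_upwards [isOpen_unitDisk.mem_nhds hw] with v hv
      exact hsub v hv
    · rw [dslope_of_ne _ hw0, dslope_of_ne _ hw0, slope_def_field, slope_def_field, h0, g0,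
        sub_zero, sub_zero, sub_zero, ← sub_div, hsub w hw, div_self hw0]
  have hD : ∀ w ∈ unitDisk, HasDerivAt (fun v => alexander h v - alexander g v - v) 0 w := by
    intro w hw
    have := ((hasDerivAt_alexander hh h0 hw).sub (hasDerivAt_alexander hg g0 hw)).sub
      (hasDerivAt_id w)
    rw [hd w hw, sub_self] at this
    exact this
  have := isOpen_unitDisk.is_const_of_deriv_eq_zero convex_unitDisk.isPreconnected
    (fun w hw => (hD w hw).differentiableAt.differentiableWithinAt)
    (fun w hw => (hD w hw).deriv) hz zero_mem_unitDisk
  simpa [sub_eq_zero] using this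

/-- The difference quotient `g z / z` is an average of `g'` over the radius `[0, z]`, so a lower
bound for `Re g'` passes to it. -/
lemma neg_half_lt_re_dslope {g : ℂ → ℂ} (hg : AnalyticOnNhd ℂ g unitDisk)
    (hre : ∀ z ∈ unitDisk, -(1 / 2) < (deriv g z).re) {z : ℂ} (hz : z ∈ unitDisk) :
    -(1 / 2) < (dslope g 0 z).re := by
  rcases eq_or_ne z 0 with rfl | hz0
  · simpa using hre 0 hz
  have hd : ∀ s ∈ Icc (0 : ℝ) 1,
      HasDerivAt (fun s : ℝ => (g (s * z) / z).re) (deriv g (s * z)).re s := by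
    intro s hs
    have hlin : HasDerivAt (fun s : ℝ => (s : ℂ) * z) z s := by
      simpa using (hasDerivAt_id s).ofReal_comp.mul_const z
    have h1 := ((hg _ (ofReal_mul_mem_unitDisk hz hs)).differentiableAt.hasDerivAt.comp s
      hlin).div_const z
    rw [mul_div_cancel_right₀ _ hz0] at h1
    exact Complex.reCLM.hasFDerivAt.comp_hasDerivAt s h1
  obtain ⟨c, hc, e⟩ := exists_hasDerivAt_eq_slope _ _ one_pos
    (fun s hs => (hd s hs).continuousAt.continuousWithinAt)
    (fun s hs => hd s (Ioo_subset_Icc_self hs))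
  have e' : (deriv g (c * z)).re = (dslope g 0 z).re := by
    rw [e, dslope_of_ne _ hz0, slope_def_field]
    simp [sub_div]
  rw [← e']
  exact hre _ (ofReal_mul_mem_unitDisk hz (Ioo_subset_Icc_self hc))

lemma isDecomposition_harmonicAlexander {f : ℂ → ℂ} (hf : f ∈ classH) :
    IsDecomposition (harmonicAlexander f) (alexander (analyticPart f))
      (alexander (coanalyticPart f)) :=
  have D := isDecomposition_parts hf
  { analytic_h := analyticOnNhd_alexander D.analytic_h D.h_zero
    analytic_g := analyticOnNhd_alexander D.analytic_g D.g_zero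
    h_zero := alexander_zero _
    g_zero := alexander_zero _
    eq_add := fun _ _ => rfl }

end PlanarHarmonic

theorem corollary2p9 (f : ℂ → ℂ)
    (hf : f ∈ PlanarHarmonic.classWHMinus (fun z => z) ∩ PlanarHarmonic.classKH0) :
    PlanarHarmonic.harmonicAlexander f ∈ PlanarHarmonic.classSH0 ∧
      PlanarHarmonic.ConvexInRealDirection
        (PlanarHarmonic.harmonicAlexander f '' PlanarHarmonic.unitDisk) := by
  open PlanarHarmonic in
  obtain ⟨⟨hH, hsub⟩, ⟨-, -, hJ⟩, -, -⟩ := hf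
  have D := isDecomposition_parts hH
  have E := isDecomposition_harmonicAlexander hH
  have hsub' : ∀ z ∈ unitDisk,
      alexander (analyticPart f) z - alexander (coanalyticPart f) z = z := fun z hz =>
    alexander_sub_alexander D.analytic_h D.analytic_g D.h_zero D.g_zero hsub hz
  have hre : ∀ z ∈ unitDisk, -(1 / 2) < (deriv (coanalyticPart f) z).re := by
    intro z hz
    have := hJ z hz
    rw [D.jacobian_eq_one_add hsub hz] at this
    linarith
  have hderiv : ∀ z ∈ unitDisk,
      deriv (alexander (coanalyticPart f)) z = dslope (coanalyticPart f) 0 z := fun z hz =>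
    (hasDerivAt_alexander D.analytic_g D.g_zero hz).deriv
  have hJ' : SensePreserving (harmonicAlexander f) := by
    intro z hz
    rw [E.jacobian_eq_one_add hsub' hz, hderiv z hz]
    linarith [neg_half_lt_re_dslope D.analytic_g hre hz]
  have hg0 : deriv (alexander (coanalyticPart f)) 0 = 0 := by
    rw [hderiv 0 zero_mem_unitDisk, dslope_same]
    simpa [D.dzbar_eq zero_mem_unitDisk] using hH.2.2.2
  exact ⟨⟨E.mem_classH hsub' hg0, E.injOn hsub' hJ', hJ'⟩, E.convexInRealDirection_image hsub' hJ'⟩
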